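/- Let $G$ be an infinite graph on countably many vertices and let $\Lambda\subset\mathbb{R}$ be a compact infinite set. Let $T$ be a bounded operator on the complex Hilbert space $\ell^2(\mathbb{N})$ that is obtained by the following construction for the data $(G,\Lambda)$. Label the vertices of $G$ by $1,2,3,\dots$, and list (without repetition) a countable dense subset $\{\lambda_1,\lambda_2,\dots\}$ of $\Lambda$. Choose real symmetric matrices $\widetilde A_1,\widetilde A_2,\dots$ such that for every $n\ge 1$ 1. $\widetilde A_n$ is an $n\times n$ matrix whose graph is the subgraph of $G$ induced by the vertices $1,\dots,n$ (that is, for $i\ne j$ the entry $(\widetilde A_n)_{ij}$ is nonzero if and only if $i$ and $j$ are adjacent), and whose spectrum is $\{\lambda_1,\dots,\lambda_n\}$; 2. $\widetilde A_n$ has the weak spectral property: the only symmetric matrix with zero diagonal that commutes with $\widetilde A_n$ is the zero matrix; 3. $\widetilde A_{n+1}$ differs from $\widetilde A_n\oplus[\lambda_{n+1}]$ only in diagonal entries and in entries of the last row and the last column, and $\|\widetilde A_n\oplus[\lambda_{n+1}]-\widetilde A_{n+1}\|_{\mathrm{op}}<2^{-n}$. Let $T_n$ be the bounded operator on $\ell^2(\mathbb{N})$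 whose matrix with respect to the standard basis is $\widetilde A_n\oplus\operatorname{diag}(\lambda_{n+1},\lambda_{n+2},\dots)$, and let $T=\lim_{n\to\infty}T_n$ in operator norm. Then $$\sigma_{\mathrm{ess}}(T)=\Lambda',$$ where $\sigma_{\mathrm{ess}}(T)=\{\lambda\in\mathbb{C}: T-\lambda I\text{ is not a Fredholm operator}\}$ is the essential spectrum of $T$ and $\Lambda'$ is the set of limit points of $\Lambda$. -/

import Mathlib

open Topology Filter

/-- The complex Hilbert space `ℓ²(ℕ)` of square-summable sequences. -/
abbrev EllTwo : Type := lp (fun _ : ℕ => ℂ) 2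

/-- The essential spectrum of a bounded operator: the set of `z : ℂ` such that `T - z I` is not a
Fredholm operator. -/
def essentialSpectrum (T : EllTwo →L[ℂ] EllTwo) : Set ℂ :=
  {z | ¬ (T - z • ContinuousLinearMap.id ℂ EllTwo).IsFredholm}

/-- The real infinite matrix `M` is the standard matrix of `T`, i.e. its matrix with respect to the
standard Hilbert basis of `ℓ²(ℕ)`. -/
def IsStandardMatrix (T : EllTwo →L[ℂ] EllTwo) (M : Matrix ℕ ℕ ℝ) : Prop :=
  ∀ i j : ℕ, (T (lp.single 2 j (1 : ℂ)) : EllTwo) i = (M i j : ℂ)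

/-- `G` is the graph of the square matrix `A`. -/
def IsGraphOf {ι : Type*} (G : SimpleGraph ι) (A : Matrix ι ι ℝ) : Prop :=
  ∀ i j : ι, i ≠ j → (A i j ≠ 0 ↔ G.Adj i j)

/-- The weak spectral property of a symmetric matrix `A`: the only symmetric matrix with zero
diagonal that commutes with `A` is the zero matrix. -/
def HasWSP {n : ℕ} (A : Matrix (Fin n) (Fin n) ℝ) : Prop :=
  ∀ X : Matrix (Fin n) (Fin n) ℝ, X.IsSymm → Matrix.hadamard X 1 = 0 → X * A - A * X = 0 → X = 0

/-- The direct sum `A ⊕ [c]` of an `n × n` matrix and a `1 × 1` matrix. -/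
def directSumEntry {n : ℕ} (A : Matrix (Fin n) (Fin n) ℝ) (c : ℝ) :
    Matrix (Fin (n + 1)) (Fin (n + 1)) ℝ :=
  Matrix.reindex finSumFinEquiv finSumFinEquiv
    (Matrix.fromBlocks A 0 0 (Matrix.diagonal fun _ : Fin 1 => c))

/-- The operator norm of a real square matrix with respect to the Euclidean norm. -/
noncomputable def matrixOpNorm {n : ℕ} (A : Matrix (Fin n) (Fin n) ℝ) : ℝ :=
  ‖Matrix.toEuclideanCLM (n := Fin n) (𝕜 := ℝ) A‖

/-- The infinite matrix `A ⊕ diag(lam n, lam (n + 1), …)`, where `A` is an `n × n` matrix. -/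
def extendByDiagonal {n : ℕ} (A : Matrix (Fin n) (Fin n) ℝ) (lam : ℕ → ℝ) : Matrix ℕ ℕ ℝ :=
  fun i j => if h : i < n ∧ j < n then A ⟨i, h.1⟩ ⟨j, h.2⟩ else if i = j then lam i else 0

/-- `lam 0, lam 1, …` lists, without repetition, a countable dense subset of `Λ`. -/
structure EnumeratesDenseSubset (lam : ℕ → ℝ) (Λ : Set ℝ) : Prop where
  injective : Function.Injective lam
  mem : ∀ n, lam n ∈ Λ
  dense : Λ ⊆ closure (Set.range lam)

/-- `A 1, A 2, …` is a sequence of finite matrices as obtained by the inductive construction for a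
graph `H` on the vertices `0, 1, 2, …` and the sequence `lam` of distinct real numbers (the empty
matrix `A 0` is only a starting point; all conditions on it are trivial). The `n × n` matrix `A n`
is symmetric, its graph is the subgraph of `H` induced by the first `n` vertices, its spectrum is
`{lam 0, …, lam (n - 1)}`, and it has the weak spectral property. Passing from `A n ⊕ [lam n]` to
`A (n + 1)` changes only diagonal entries and entries of the last row and column, and it changes
the matrix by less than `1 / 2 ^ n` in operator norm. -/
structure IsInductiveSequence (H : SimpleGraph ℕ) (lam : ℕ → ℝ)
    (A : (n : ℕ) → Matrix (Fin n) (Fin n) ℝ) : Prop where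
  symm : ∀ n, (A n).IsSymm
  graph : ∀ n, IsGraphOf (H.comap (fun i : Fin n => (i : ℕ))) (A n)
  spec : ∀ n, spectrum ℝ (A n) = lam '' {i | i < n}
  wsp : ∀ n, HasWSP (A n)
  offDiag : ∀ (n : ℕ) (i j : Fin n), i ≠ j → A (n + 1) i.castSucc j.castSucc = A n i j
  close : ∀ n, matrixOpNorm (directSumEntry (A n) (lam n) - A (n + 1)) < 1 / 2 ^ n

/-- `T` is obtained by the construction for the data `(G, Λ)`: the vertices of `G` are labelled by
`ℕ`, a countable dense subset of `Λ` is listed as `lam 0, lam 1, …`, matrices `A n` are chosen by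
the inductive construction, and `T` is the limit in operator norm of the operators `Tn n` with
standard matrices `A n ⊕ diag(lam n, lam (n + 1), …)`, `n ≥ 1`. -/
def IsConstructedSolution {V : Type*} (G : SimpleGraph V) (Λ : Set ℝ)
    (T : EllTwo →L[ℂ] EllTwo) : Prop :=
  ∃ (e : ℕ ≃ V) (lam : ℕ → ℝ) (A : (n : ℕ) → Matrix (Fin n) (Fin n) ℝ)
    (Tn : ℕ → EllTwo →L[ℂ] EllTwo),
    EnumeratesDenseSubset lam Λ ∧
    IsInductiveSequence (G.comap e) lam A ∧
    (∀ n, 1 ≤ n → IsStandardMatrix (Tn n) (extendByDiagonal (A n) lam)) ∧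
    Tendsto Tn atTop (𝓝 T)

/-!
Whatever the finite block `A n` is, the operator `Tn n` multiplies the basis vector `e_j` by `lam j`
for every `j ≥ n`, so it is a finite-rank perturbation of the diagonal operator with entries
`lam 0, lam 1, …`, and `T` is a compact perturbation of it. Hence `T` has the essential spectrum of
the diagonal operator, which is the set of limit points of the sequence `lam`; this is `derivedSet Λ`
because `lam` lists a dense subset of `Λ`. The invariance of the essential spectrum is obtained by
hand, in two halves.

* If `z` is not a limit point, replace the at most one zero entry of `diag(lam j - z)` by `1` to get
  an invertible diagonal operator `B` (`exists_isUnit_apply_single_eq_smul`). For large `n` the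
  operator `B + (T - Tn n)` is still invertible, and it differs from `T - z` by an operator that
  vanishes on all but finitely many basis vectors, hence has finite rank. So `T - z` is Fredholm
  (`isFredholm_of_isUnit_of_hasFiniteRange`).
* If `z` is a limit point, then `(T - z) e_j` tends to `0` as `lam j` tends to `z`, which is
  impossible for a Fredholm operator (`not_isFredholm_of_tendsto_apply_single`).
-/

open ContinuousLinearMap in
/-- A finite-rank perturbation of an invertible operator is Fredholm, with the inverse of the
unperturbed operator as a quasi-inverse. -/
lemma isFredholm_of_isUnit_of_hasFiniteRange {S U : EllTwo →L[ℂ] EllTwo} (hU : IsUnit U)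
    (hK : LinearMap.HasFiniteRange ((S - U : EllTwo →L[ℂ] EllTwo) : EllTwo →ₗ[ℂ] EllTwo)) :
    S.IsFredholm := by
  obtain ⟨u, rfl⟩ := hU
  refine IsFredholm.of_isQuasiInverse (v := (↑u⁻¹ : EllTwo →L[ℂ] EllTwo)) ⟨?_, ?_⟩
  · refine LinearMap.FiniteRangeSetoid.equiv_iff_hasFiniteRange.2 ?_
    refine (congrArg LinearMap.HasFiniteRange (LinearMap.ext fun x => ?_)).mpr
      (hK.comp_left ((↑u⁻¹ : EllTwo →L[ℂ] EllTwo) : EllTwo →ₗ[ℂ] EllTwo))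
    have h : (↑u⁻¹ : EllTwo →L[ℂ] EllTwo) ((u : EllTwo →L[ℂ] EllTwo) x) = x :=
      DFunLike.congr_fun u.inv_mul x
    simp [h]
  · refine LinearMap.FiniteRangeSetoid.equiv_iff_hasFiniteRange.2 ?_
    refine (congrArg LinearMap.HasFiniteRange (LinearMap.ext fun x => ?_)).mpr
      (hK.comp_right ((↑u⁻¹ : EllTwo →L[ℂ] EllTwo) : EllTwo →ₗ[ℂ] EllTwo))
    have h : (u : EllTwo →L[ℂ] EllTwo) ((↑u⁻¹ : EllTwo →L[ℂ] EllTwo) x) = x :=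
      DFunLike.congr_fun u.mul_inv x
    simp [h]

lemma hasSum_smul_apply_single (K : EllTwo →L[ℂ] EllTwo) (x : EllTwo) :
    HasSum (fun j => x j • K (lp.single 2 j (1 : ℂ))) (K x) := by
  have h := (lp.hasSum_single (by norm_num) x).mapL K
  convert h using 2 with j
  rw [← map_smul, ← lp.single_smul, smul_eq_mul, mul_one]

lemma hasFiniteRange_of_apply_single_eq_zero {K : EllTwo →L[ℂ] EllTwo} {N : ℕ}
    (hK : ∀ j, N ≤ j → K (lp.single 2 j (1 : ℂ)) = 0) :
    LinearMap.HasFiniteRange (K : EllTwo →ₗ[ℂ] EllTwo) := by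
  rw [LinearMap.hasFiniteRange_iff_range]
  have hfin : (((fun j => K (lp.single 2 j (1 : ℂ))) '' ↑(Finset.range N))).Finite :=
    (Finset.range N).finite_toSet.image _
  refine Submodule.FG.of_le (Submodule.fg_span hfin) ?_
  rintro _ ⟨x, rfl⟩
  have h := (hasSum_smul_apply_single K x).unique
    (hasSum_sum_of_ne_finset_zero (s := Finset.range N) fun j hj => by
      rw [hK j (by simpa using hj), smul_zero])
  rw [ContinuousLinearMap.coe_coe, h]
  exact Submodule.sum_mem _ fun j hj =>
    Submodule.smul_mem _ _ (Submodule.subset_span ⟨j, hj, rfl⟩)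

/-- A bounded diagonal operator whose diagonal entries are bounded away from zero is invertible. -/
lemma exists_isUnit_apply_single_eq_smul {b : ℕ → ℂ} {C δ : ℝ} (hδ : 0 < δ)
    (hC : ∀ j, ‖b j‖ ≤ C) (hb : ∀ j, δ ≤ ‖b j‖) :
    ∃ B : EllTwo →L[ℂ] EllTwo, IsUnit B ∧
      ∀ j, B (lp.single 2 j (1 : ℂ)) = b j • lp.single 2 j (1 : ℂ) := by
  have hb0 : ∀ j, b j ≠ 0 := fun j => norm_pos_iff.1 (hδ.trans_le (hb j))
  let B : EllTwo →L[ℂ] EllTwo := lp.mapCLM 2 (fun j => b j • ContinuousLinearMap.id ℂ ℂ)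
    ((norm_nonneg _).trans (hC 0)) (fun j => by simpa [norm_smul] using hC j)
  let B' : EllTwo →L[ℂ] EllTwo := lp.mapCLM 2 (fun j => (b j)⁻¹ • ContinuousLinearMap.id ℂ ℂ)
    (inv_nonneg.2 hδ.le) (fun j => by
      simpa [norm_smul] using inv_anti₀ hδ (hb j))
  have h1 : B * B' = 1 := by
    ext x j
    simp [B, B', hb0 j]
  have h2 : B' * B = 1 := by
    ext x j
    simp [B, B', hb0 j]
  refine ⟨B, ⟨⟨B, B', h1, h2⟩, rfl⟩, fun j => ?_⟩
  ext i
  rcases eq_or_ne i j with rfl | hij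
  · simp [B]
  · simp [B, hij]

/-- A Fredholm operator cannot be small on infinitely many standard basis vectors: a quasi-inverse
differs from an inverse by a finite-rank operator, which maps the basis vectors into a compact set,
so a subfamily of the basis vectors would converge, whereas only a limit of norm one with all
coordinates zero is possible. -/
lemma not_isFredholm_of_tendsto_apply_single {S : EllTwo →L[ℂ] EllTwo} {F : Filter ℕ} [F.NeBot]
    (hF : F ≤ cofinite) (hS : Tendsto (fun j => S (lp.single 2 j (1 : ℂ))) F (𝓝 0)) :
    ¬ S.IsFredholm := by
  intro h
  obtain ⟨v, hv, -⟩ := h.exists_isQuasiInverse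
  let R : EllTwo →L[ℂ] EllTwo := v ∘L S - ContinuousLinearMap.id ℂ EllTwo
  have hR : Module.Finite ℂ R.range :=
    Module.Finite.iff_fg.2 (LinearMap.FiniteRangeSetoid.equiv_iff_hasFiniteRange.1 hv)
  have : ProperSpace R.range := FiniteDimensional.proper ℂ _
  have hnorm : ∀ j : ℕ, ‖(lp.single 2 j (1 : ℂ) : EllTwo)‖ = 1 := fun j => by
    rw [lp.norm_single (by norm_num), norm_one]
  have hcompact : IsCompact (Subtype.val '' Metric.closedBall (0 : R.range) ‖R‖) :=
    (isCompact_closedBall _ _).image continuous_subtype_val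
  let U : Ultrafilter ℕ := Ultrafilter.of F
  have hUF : (U : Filter ℕ) ≤ F := Ultrafilter.of_le F
  obtain ⟨y, -, hy⟩ := hcompact.ultrafilter_le_nhds
    (U.map fun j => R (lp.single 2 j (1 : ℂ))) (by
      rw [Ultrafilter.coe_map, le_principal_iff, mem_map]
      refine univ_mem' fun j => ⟨⟨_, LinearMap.mem_range_self R.toLinearMap _⟩, ?_, rfl⟩
      rw [mem_closedBall_zero_iff]
      simpa [hnorm j] using R.le_opNorm (lp.single 2 j (1 : ℂ)))
  have hRlim : Tendsto (fun j => R (lp.single 2 j (1 : ℂ))) U (𝓝 y) := hy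
  have hlim : Tendsto (fun j => (lp.single 2 j (1 : ℂ) : EllTwo)) U (𝓝 (v 0 - y)) := by
    refine (((v.continuous.tendsto 0).comp (hS.mono_left hUF)).sub hRlim).congr fun j => ?_
    simp [R]
  have hone : ‖v 0 - y‖ = 1 := by
    refine tendsto_nhds_unique hlim.norm ?_
    simp only [hnorm, tendsto_const_nhds]
  have hzero : v 0 - y = 0 := by
    ext i
    have hcoord := ((lp.evalCLM ℂ (fun _ : ℕ => ℂ) 2 i).continuous.tendsto _).comp hlim
    refine tendsto_nhds_unique hcoord (tendsto_const_nhds.congr' ?_)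
    have hne : ∀ᶠ j in (U : Filter ℕ), j ≠ i := (hUF.trans hF) (by simp)
    filter_upwards [hne] with j hj
    exact (lp.single_apply_ne (E := fun _ : ℕ => ℂ) 2 j 1 hj.symm).symm
  rw [hzero, norm_zero] at hone
  exact zero_ne_one hone

lemma derivedSet_eq_derivedSet_range {lam : ℕ → ℝ} {Λ : Set ℝ}
    (h : EnumeratesDenseSubset lam Λ) : derivedSet Λ = derivedSet (Set.range lam) := by
  refine (derivedSet_mono _ _ h.dense).trans_eq (derivedSet_closure _) |>.antisymm
    (derivedSet_mono _ _ ?_)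
  rintro _ ⟨n, rfl⟩
  exact h.mem n

/-- Off the limit points of the range of `lam`, whether real or not, `z` has positive distance from
the terms of `lam` different from `z`. -/
lemma exists_pos_le_norm_sub_of_notMem {lam : ℕ → ℝ} {z : ℂ}
    (hz : z ∉ Complex.ofReal '' derivedSet (Set.range lam)) :
    ∃ δ > 0, ∀ j, (lam j : ℂ) ≠ z → δ ≤ ‖(lam j : ℂ) - z‖ := by
  by_cases him : z.im = 0
  · obtain ⟨x, rfl⟩ : ∃ x : ℝ, (x : ℂ) = z := ⟨z.re, Complex.ext rfl (by simp [him])⟩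
    have hx : ¬ AccPt x (𝓟 (Set.range lam)) := fun h => hz ⟨x, h, rfl⟩
    rw [accPt_iff_frequently, not_frequently, Metric.eventually_nhds_iff] at hx
    obtain ⟨δ, hδ, h⟩ := hx
    refine ⟨δ, hδ, fun j hj => not_lt.1 fun hlt => ?_⟩
    rw [← Complex.ofReal_sub, Complex.norm_real, ← dist_eq_norm] at hlt
    exact h hlt ⟨fun he => hj (by rw [he]), j, rfl⟩
  · -- The `lam j` are real, so their distance to `z` is at least the distance to the real axis.
    refine ⟨|z.im|, abs_pos.2 him, fun j _ => ?_⟩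
    simpa using Complex.abs_im_le_norm ((lam j : ℂ) - z)

lemma apply_single_of_isStandardMatrix_extendByDiagonal {S : EllTwo →L[ℂ] EllTwo} {n : ℕ}
    {A : Matrix (Fin n) (Fin n) ℝ} {lam : ℕ → ℝ} (hS : IsStandardMatrix S (extendByDiagonal A lam))
    {j : ℕ} (hj : n ≤ j) :
    S (lp.single 2 j (1 : ℂ)) = (lam j : ℂ) • lp.single 2 j (1 : ℂ) := by
  ext i
  rw [hS i j, lp.coeFn_smul, Pi.smul_apply, smul_eq_mul]
  rcases eq_or_ne i j with rfl | hij
  · simp [extendByDiagonal, hj.not_gt]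
  · simp [extendByDiagonal, hj.not_gt, hij]

/-- If `T` is obtained by the construction for the data `(G, Λ)`, then the essential spectrum of `T`
is the set of limit points of `Λ`. -/
theorem mainTheorem3 {V : Type*} [Countable V] [Infinite V] (G : SimpleGraph V)
    (Λ : Set ℝ) (hcompact : IsCompact Λ) (hinfinite : Λ.Infinite)
    (T : EllTwo →L[ℂ] EllTwo) (hT : IsConstructedSolution G Λ T) :
    essentialSpectrum T = Complex.ofReal '' derivedSet Λ := by
  obtain ⟨e, lam, A, Tn, hlam, -, hTn, hlim⟩ := hT
  have hdiag : ∀ n, 1 ≤ n → ∀ j, n ≤ j →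
      Tn n (lp.single 2 j (1 : ℂ)) = (lam j : ℂ) • lp.single 2 j (1 : ℂ) := fun n hn j hj =>
    apply_single_of_isStandardMatrix_extendByDiagonal (hTn n hn) hj
  rw [derivedSet_eq_derivedSet_range hlam]
  refine Set.Subset.antisymm (fun z hz => ?_) ?_
  · by_contra hacc
    obtain ⟨δ, hδ, hgap⟩ := exists_pos_le_norm_sub_of_notMem hacc
    obtain ⟨C, hC⟩ := hcompact.isBounded.exists_norm_le
    -- The unperturbed diagonal operator minus `z`, with its possible zero entry replaced by `1`.
    let b : ℕ → ℂ := fun j => if (lam j : ℂ) = z then 1 else lam j - z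
    obtain ⟨B, hB, hBdiag⟩ := exists_isUnit_apply_single_eq_smul (b := b)
      (C := max 1 (C + ‖z‖)) (lt_min hδ one_pos) (fun j => by
        by_cases h : (lam j : ℂ) = z
        · simp [b, h]
        · simp only [b, if_neg h]
          refine (norm_sub_le _ _).trans (le_max_of_le_right ?_)
          rw [Complex.norm_real]
          gcongr
          exact hC _ (hlam.mem j)) (fun j => by
        by_cases h : (lam j : ℂ) = z
        · simp [b, h]
        · simp only [b, if_neg h]
          exact (min_le_left _ _).trans (hgap j h))
    obtain ⟨N, hN⟩ : ∃ N, ∀ j, N ≤ j → (lam j : ℂ) ≠ z := by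
      by_cases h : ∃ k, (lam k : ℂ) = z
      · obtain ⟨k, hk⟩ := h
        refine ⟨k + 1, fun j hj hjz => ?_⟩
        have := hlam.injective (Complex.ofReal_injective (hjz.trans hk.symm))
        omega
      · exact ⟨0, fun j _ hjz => h ⟨j, hjz⟩⟩
    have hunit : ∀ᶠ n in atTop, IsUnit (B + (T - Tn n)) := by
      have : Tendsto (fun n => B + (T - Tn n)) atTop (𝓝 B) := by
        simpa using (hlim.const_sub T).const_add B
      exact this.eventually (Units.isOpen.mem_nhds hB)
    obtain ⟨n, hn, hn1⟩ := (hunit.and (eventually_ge_atTop 1)).exists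
    refine hz (isFredholm_of_isUnit_of_hasFiniteRange hn
      (hasFiniteRange_of_apply_single_eq_zero (N := max n N) fun j hj => ?_))
    have h1 := hdiag n hn1 j ((le_max_left _ _).trans hj)
    have h2 : b j = lam j - z := if_neg (hN j ((le_max_right _ _).trans hj))
    simp only [sub_apply, add_apply, h1, hBdiag, h2,
      smul_apply, ContinuousLinearMap.id_apply]
    module
  · rintro _ ⟨x, hx, rfl⟩
    have hne : (comap lam (𝓝[≠] x)).NeBot :=
      comap_neBot_iff_frequently.2 (accPt_iff_frequently_nhdsNE.1 hx)
    have hcof : comap lam (𝓝[≠] x) ≤ cofinite :=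
      (comap_mono (nhdsNE_le_cofinite x)).trans (comap_cofinite_le lam)
    refine not_isFredholm_of_tendsto_apply_single hcof ?_
    have hlamx : Tendsto lam (comap lam (𝓝[≠] x)) (𝓝 x) :=
      tendsto_comap.mono_right nhdsWithin_le_nhds
    rw [Metric.tendsto_nhds]
    intro ε hε
    -- Approximate `T` by `Tn n`, then take `j ≥ n`, where `Tn n` acts as multiplication by `lam j`.
    obtain ⟨n, hn, hn1⟩ := ((Metric.tendsto_nhds.1 hlim (ε / 2) (half_pos hε)).and
      (eventually_ge_atTop 1)).exists
    have hlarge : ∀ᶠ j in comap lam (𝓝[≠] x), n ≤ j :=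
      hcof (by simpa [Nat.cofinite_eq_atTop] using eventually_ge_atTop n)
    filter_upwards [hlarge, Metric.tendsto_nhds.1 hlamx (ε / 2) (half_pos hε)] with j hj hjx
    have hnorm : ‖(lp.single 2 j (1 : ℂ) : EllTwo)‖ = 1 := by
      rw [lp.norm_single (by norm_num), norm_one]
    have hsplit : (T - (x : ℂ) • ContinuousLinearMap.id ℂ EllTwo) (lp.single 2 j (1 : ℂ)) =
        (T - Tn n) (lp.single 2 j (1 : ℂ)) + ((lam j : ℂ) - x) • lp.single 2 j (1 : ℂ) := by
      simp only [sub_apply, hdiag n hn1 j hj,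
        smul_apply, ContinuousLinearMap.id_apply]
      module
    rw [dist_zero_right, hsplit]
    calc _ ≤ ‖(T - Tn n) (lp.single 2 j (1 : ℂ))‖
          + ‖((lam j : ℂ) - x) • (lp.single 2 j (1 : ℂ) : EllTwo)‖ := norm_add_le _ _
      _ ≤ ‖T - Tn n‖ + ‖(lam j : ℂ) - x‖ := by
        rw [norm_smul, hnorm, mul_one]
        gcongr
        simpa [hnorm] using (T - Tn n).le_opNorm (lp.single 2 j (1 : ℂ))
      _ < ε / 2 + ε / 2 := by
        rw [← Complex.ofReal_sub, Complex.norm_real, ← dist_eq_norm, ← dist_eq_norm]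
        rw [dist_comm] at hn
        gcongr
      _ = ε := add_halves ε
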